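/- Let $X=\mathbb R^K$ with the Euclidean norm, $N\ge 1$, $I=\{1,\dots,N\}$, $\gamma>0$, $\kappa>0$, $L\ge 0$. For $j\in I$ let $\Phi_j\in C^1(X;\mathbb R)$ have an $L$-Lipschitz gradient and be strongly convex with constant $\kappa$, i.e. $\langle x-y,\nabla\Phi_j(x)-\nabla\Phi_j(y)\rangle\ge\kappa\|x-y\|^2$ for all $x,y\in X$. Let $(i(t))_{t\ge0}$ (the index process) be a continuous-time Markov process on $I$ with càdlàg paths, uniform initial distribution and transition rate matrix $\mathbf\Gamma_N-N\gamma\mathbf I_N$, where all entries of the $N\times N$ matrix $\mathbf\Gamma_N$ equal $\gamma$. Let $m:[0,\infty)\to(0,\infty)$ be strictly decreasing and differentiable with $\lim_{t\to\infty}m(t)=0$, $m_0:=m(0)\le 1$ and $|m'(t)|\le\lambda\,m(t)$ for all $t>0$, where $\lambda=\min\{\kappa/4,1/4\}$. For deterministic $q_0,p_0,\theta_0\in X$ let $(q_t,p_t)_{t\ge0}$ be the decreasing-mass stochastic gradient-momentum process $$dq_t=p_t\,dt,\qquad m(t)\,dp_t=-\nabla\Phi_{i(t)}(q_t)\,dt-p_t\,dt,\qquad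 q(0)=q_0,\ p(0)=p_0,$$ and let $(\theta_t)_{t\ge0}$ be the stochastic gradient process driven by the same index process, $$d\theta_t=-\nabla\Phi_{i(t)}(\theta_t)\,dt,\qquad \theta(0)=\theta_0 .$$ Put $C^{(1)}_L=1+8L^2+8L$, $C^{(2)}_L=8(C^{(1)}_L)^2$, $C^{(1)}_{L,\kappa}=2C^{(2)}_L\kappa^{-1/2}(1+\kappa^{-1/2}+\kappa^{1/2})+\kappa^{1/2}$, $C^{(2)}_{L,\kappa}=C^{(1)}_{L,\kappa}+C^{(1)}_L$, and assume $$m_0\le\frac{(C^{(2)}_{L,\kappa})^{-2}\kappa^2}{4(2\gamma N+\kappa)^2}.$$ (i) If $N\ge2$ (for $N=1$ the process $i$ never jumps), let $\tau_0=0$ and let $\tau_1<\tau_2<\cdots$ be the successive jump times of $(i(t))_{t\ge0}$, which almost surely all exist. Then $q_{\tau_n}-\theta_{\tau_n}$ is integrable for every $n$, and $\mathbb E\big[\|q_{\tau_n}-\theta_{\tau_n}\|\big]\to0$ as $n\to\infty$. (ii) If, in addition to the standing assumptions, there are $C,c>0$ with $m(t)\le Ce^{-ct}$ for all $t\ge0$,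 then $\|q_t-\theta_t\|\to0$ as $t\to\infty$ almost surely, $q_t-\theta_t$ is integrable for every $t\ge 0$, and $\mathbb E\big[\|q_t-\theta_t\|\big]\to0$ as $t\to\infty$. -/

import Mathlib

open MeasureTheory ProbabilityTheory Filter Topology
open scoped NNReal Gradient

noncomputable section

namespace SGMP

/-- A path on `[0, ∞)` with values in a topological space is càdlàg: right-continuous with left
limits. -/
def IsCadlag {ι : Type*} [TopologicalSpace ι] (x : ℝ → ι) : Prop :=
  (∀ t, 0 ≤ t → ContinuousWithinAt x (Set.Ici t) t) ∧
    ∀ t, 0 < t → ∃ l, Tendsto x (𝓝[<] t) (𝓝 l)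

/-- The family `(X t)_{t ≥ 0}` is a homogeneous continuous-time Markov process on the finite
state space `ι` with transition rate matrix `Q`: almost all paths are càdlàg and, for all
`0 ≤ s ≤ t`, every event `A` of the past `σ(X r : 0 ≤ r ≤ s)` and all states `j`, `k`,
`P(A, X s = j, X t = k) = P(A, X s = j) * (exp ((t - s) Q))_{j k}`. -/
structure IsMarkovProcess {Ω ι : Type*} [MeasurableSpace Ω] [Fintype ι] [DecidableEq ι]
    [TopologicalSpace ι] [MeasurableSpace ι] (P : Measure Ω) (Q : Matrix ι ι ℝ)
    (X : ℝ → Ω → ι) : Prop where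
  measurable : ∀ t, 0 ≤ t → Measurable (X t)
  cadlag : ∀ᵐ ω ∂P, IsCadlag fun t => X t ω
  markov : ∀ s t, 0 ≤ s → s ≤ t → ∀ A : Set Ω,
    MeasurableSet[⨆ r ∈ Set.Icc 0 s, MeasurableSpace.comap (X r) inferInstance] A →
    ∀ j k : ι, P.real (A ∩ {ω | X s ω = j} ∩ {ω | X t ω = k}) =
      P.real (A ∩ {ω | X s ω = j}) * NormedSpace.exp ((t - s) • Q) j k

/-- The transition rate matrix `Γ_N - N γ I_N`, where all entries of `Γ_N` are `γ`. -/
def rateMatrix (N : ℕ) (γ : ℝ) : Matrix (Fin N) (Fin N) ℝ :=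
  Matrix.of (fun _ _ => γ) - ((N : ℝ) * γ) • (1 : Matrix (Fin N) (Fin N) ℝ)

/-- The index process: the Markov process with rate matrix `rateMatrix N γ` started in the uniform
distribution. -/
structure IsIndexProcess {Ω : Type*} [MeasurableSpace Ω] (P : Measure Ω) (N : ℕ) (γ : ℝ)
    (i : ℝ → Ω → Fin N) : Prop where
  isMarkov : IsMarkovProcess P (rateMatrix N γ) i
  initial : ∀ j, P.real {ω | i 0 ω = j} = 1 / (N : ℝ)

/-- The jump times of a path: `τ 0 = 0`, and `τ (n + 1)` is the first discontinuity after `τ n`. -/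
def jumpTime {ι : Type*} [TopologicalSpace ι] (x : ℝ → ι) : ℕ → ℝ
  | 0 => 0
  | n + 1 => sInf {t | jumpTime x n < t ∧ ¬ ContinuousAt x t}

/-- The stochastic gradient process `dθ = -∇Φ_{i(t)}(θ) dt`, `θ(0) = θ₀`. As `i` is only
right-continuous, the equation is required for continuous paths and right derivatives, which is
equivalent to the integral equation. -/
structure IsSGP {Ω : Type*} [MeasurableSpace Ω] {K N : ℕ} (P : Measure Ω)
    (Φ : Fin N → EuclideanSpace ℝ (Fin K) → ℝ) (i : ℝ → Ω → Fin N)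
    (θ₀ : EuclideanSpace ℝ (Fin K)) (θ : ℝ → Ω → EuclideanSpace ℝ (Fin K)) : Prop where
  measurable : ∀ t, 0 ≤ t → Measurable (θ t)
  initial : ∀ᵐ ω ∂P, θ 0 ω = θ₀
  continuousOn : ∀ᵐ ω ∂P, ContinuousOn (fun t => θ t ω) (Set.Ici 0)
  deriv : ∀ᵐ ω ∂P, ∀ t, 0 ≤ t →
    HasDerivWithinAt (fun s => θ s ω) (-∇ (Φ (i t ω)) (θ t ω)) (Set.Ici t) t

/-- The stochastic gradient-momentum process with time-dependent mass:
`dq = p dt`, `m(t) dp = -∇Φ_{i(t)}(q) dt - p dt`, `q(0) = q₀`, `p(0) = p₀`. -/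
structure IsSGMP {Ω : Type*} [MeasurableSpace Ω] {K N : ℕ} (P : Measure Ω)
    (Φ : Fin N → EuclideanSpace ℝ (Fin K) → ℝ) (m : ℝ → ℝ) (i : ℝ → Ω → Fin N)
    (q₀ p₀ : EuclideanSpace ℝ (Fin K)) (q p : ℝ → Ω → EuclideanSpace ℝ (Fin K)) : Prop where
  measurable_q : ∀ t, 0 ≤ t → Measurable (q t)
  measurable_p : ∀ t, 0 ≤ t → Measurable (p t)
  initial : ∀ᵐ ω ∂P, q 0 ω = q₀ ∧ p 0 ω = p₀
  continuousOn_q : ∀ᵐ ω ∂P, ContinuousOn (fun t => q t ω) (Set.Ici 0)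
  continuousOn_p : ∀ᵐ ω ∂P, ContinuousOn (fun t => p t ω) (Set.Ici 0)
  deriv_q : ∀ᵐ ω ∂P, ∀ t, 0 ≤ t →
    HasDerivWithinAt (fun s => q s ω) (p t ω) (Set.Ici t) t
  deriv_p : ∀ᵐ ω ∂P, ∀ t, 0 ≤ t →
    HasDerivWithinAt (fun s => p s ω)
      ((m t)⁻¹ • (-∇ (Φ (i t ω)) (q t ω) - p t ω)) (Set.Ici t) t

/-- A mass function on `[0, ∞)`: positive, strictly decreasing, differentiable, vanishing at
infinity, with `|m'| ≤ lam * m` on `(0, ∞)` and `m 0 ≤ 1`. -/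
structure IsMass (lam : ℝ) (m : ℝ → ℝ) : Prop where
  pos : ∀ t, 0 ≤ t → 0 < m t
  strictAntiOn : StrictAntiOn m (Set.Ici 0)
  differentiableOn : DifferentiableOn ℝ m (Set.Ici 0)
  tendsto : Tendsto m atTop (𝓝 0)
  abs_deriv_le : ∀ t, 0 < t → |deriv m t| ≤ lam * m t
  initial_le : m 0 ≤ 1

/-- Strong convexity of a differentiable function with constant `κ`, through its gradient. -/
def StronglyConvex {K : ℕ} (κ : ℝ) (f : EuclideanSpace ℝ (Fin K) → ℝ) : Prop :=
  ∀ x y, κ * ‖x - y‖ ^ 2 ≤ inner ℝ (x - y) (∇ f x - ∇ f y)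

/-- `C^{(1)}_L = 1 + 8 L² + 8 L`. -/
def C1L (L : ℝ) : ℝ := 1 + 8 * L ^ 2 + 8 * L

/-- `C^{(2)}_L = 8 (C^{(1)}_L)²`. -/
def C2L (L : ℝ) : ℝ := 8 * C1L L ^ 2

/-- `C^{(1)}_{L,κ} = 2 C^{(2)}_L κ^{-1/2} (1 + κ^{-1/2} + κ^{1/2}) + κ^{1/2}`. -/
def C1Lκ (L κ : ℝ) : ℝ :=
  2 * C2L L * (√κ)⁻¹ * (1 + (√κ)⁻¹ + √κ) + √κ

/-- `C^{(2)}_{L,κ} = C^{(1)}_{L,κ} + C^{(1)}_L`. -/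
def C2Lκ (L κ : ℝ) : ℝ := C1Lκ L κ + C1L L

end SGMP

end

/-! The argument is pathwise. With `r = m p` and `u = q + r`, adding the two momentum equations
cancels the stiff term `-p`, so `u' = m' p - ∇Φ(q)` with `|m'| ≤ m`: up to errors of size `‖r‖`, `u`
follows the same gradient flow as `θ`, and strong convexity contracts `u - θ`. The equation for `r`
contains the friction `-p = -r/m`, which absorbs every error in `‖r‖` once `m` is small. As `m → 0`,
this happens from some deterministic time `T` on.

After `T`, `‖u‖² + ‖r‖²` stays bounded (`energy_deriv_le`). Hence the gradients are bounded by some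
`B`, and `F = ‖u - θ‖² + ‖r‖²` satisfies `F' ≤ -κ F + B² m` (`distance_deriv_le`). Before `T`, a
crude Grönwall bound suffices. All constants depend only on `κ`, `L`, the gradients at the origin,
`m` and the initial values, not on the index path. So `exists_bound_and_tendsto` yields a
deterministic bound on `‖q - θ‖` together with convergence to zero along each path, and dominated
convergence gives the limits in expectation.

For the jump times it remains to show that they exist, tend to infinity and are measurable up to
null sets. The chain almost surely never settles in one state, càdlàg paths in a discrete space have
no accumulating jumps, and each jump can be detected at rational times. -/

namespace SGMP

/-! ### Energy estimates along a single path -/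

section Deterministic

variable {E : Type*} [NormedAddCommGroup E] [InnerProductSpace ℝ E]

/-- A time-dependent vector field which is, uniformly in time, bounded by `G` at the origin,
`L`-Lipschitz and `κ`-strongly monotone. No regularity in time is assumed. -/
structure IsMonotoneField (κ L G : ℝ) (g : ℝ → E → E) : Prop where
  norm_zero_le : ∀ t, ‖g t 0‖ ≤ G
  lipschitz : ∀ t x y, ‖g t x - g t y‖ ≤ L * ‖x - y‖
  monotone : ∀ t x y, κ * ‖x - y‖ ^ 2 ≤ inner ℝ (x - y) (g t x - g t y)

/-- A triple `(q, p, θ)` of continuous paths, where `(q, p)` solves the momentum equation with mass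
`m` and `θ` the gradient equation, both driven by the field `g`. -/
structure IsCoupledPath (m : ℝ → ℝ) (g : ℝ → E → E) (q₀ p₀ θ₀ : E) (q p θ : ℝ → E) : Prop where
  q_zero : q 0 = q₀
  p_zero : p 0 = p₀
  θ_zero : θ 0 = θ₀
  continuousOn_q : ContinuousOn q (Set.Ici 0)
  continuousOn_p : ContinuousOn p (Set.Ici 0)
  continuousOn_θ : ContinuousOn θ (Set.Ici 0)
  deriv_q : ∀ t, 0 ≤ t → HasDerivWithinAt q (p t) (Set.Ici t) t
  deriv_p : ∀ t, 0 ≤ t → HasDerivWithinAt p ((m t)⁻¹ • (-g t (q t) - p t)) (Set.Ici t) t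
  deriv_θ : ∀ t, 0 ≤ t → HasDerivWithinAt θ (-g t (θ t)) (Set.Ici t) t

lemma IsMonotoneField.norm_le {κ L G : ℝ} {g : ℝ → E → E} (hg : IsMonotoneField κ L G g)
    (t : ℝ) (x : E) : ‖g t x‖ ≤ G + L * ‖x‖ := by
  have h := hg.lipschitz t x 0
  have h' := norm_le_norm_add_norm_sub (g t 0) (g t x)
  rw [norm_sub_rev] at h'
  simp only [sub_zero] at h
  linarith [hg.norm_zero_le t]

/-- Scalar comparison: a right-differentiable function with `f' ≤ -κ f + ε` is bounded by the
solution of the corresponding linear equation. -/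
lemma le_of_deriv_right_le_neg_mul_add {f f' : ℝ → ℝ} {a κ ε : ℝ} (hκ : 0 < κ) (hε : 0 ≤ ε)
    (hf : ContinuousOn f (Set.Ici a))
    (hf' : ∀ t, a ≤ t → HasDerivWithinAt f (f' t) (Set.Ici t) t)
    (hb : ∀ t, a ≤ t → f' t ≤ -κ * f t + ε) (t : ℝ) (ht : a ≤ t) :
    f t ≤ f a * Real.exp (-κ * (t - a)) + ε / κ := by
  have h := le_gronwallBound_of_liminf_deriv_right_le (f := f) (f' := f') (δ := f a) (K := -κ)
    (ε := ε) (a := a) (b := t) (hf.mono Set.Icc_subset_Ici_self)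
    (fun x hx r hr => (hf' x hx.1).liminf_right_slope_le hr) le_rfl (fun x hx => hb x hx.1) t
    ⟨ht, le_rfl⟩
  rw [gronwallBound_of_K_ne_0 (neg_ne_zero.2 hκ.ne')] at h
  refine h.trans ?_
  have : 0 ≤ ε / κ * Real.exp (-κ * (t - a)) := by positivity
  simp only [div_neg]
  linarith

variable {m : ℝ → ℝ} {g : ℝ → E → E} {κ L G : ℝ} {q₀ p₀ θ₀ : E} {q p θ : ℝ → E}

/-- On a compact time interval the solutions are bounded uniformly over all fields. -/
lemma exists_norm_le_of_isCoupledPath (hL : 0 ≤ L) (hG : 0 ≤ G)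
    (hpos : ∀ t, 0 ≤ t → 0 < m t) (hanti : AntitoneOn m (Set.Ici 0)) (q₀ p₀ θ₀ : E) (T : ℝ)
    (hT : 0 ≤ T) :
    ∃ R, ∀ (g : ℝ → E → E) (q p θ : ℝ → E), IsMonotoneField κ L G g →
      IsCoupledPath m g q₀ p₀ θ₀ q p θ →
      ∀ t ∈ Set.Icc 0 T, ‖q t‖ ≤ R ∧ ‖p t‖ ≤ R ∧ ‖θ t‖ ≤ R := by
  -- On `[0, T]` the factor `1/m` is at most `1/m(T)`, so the joint system grows at most linearly
  -- with constants free of the particular field.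
  set M := (m T)⁻¹
  have hM : 0 ≤ M := (inv_pos.2 (hpos T hT)).le
  refine ⟨gronwallBound ‖(q₀, p₀, θ₀)‖ (1 + M * (L + 1) + L) ((M + 1) * G) T,
    fun g q p θ hg h t ht => ?_⟩
  have key := norm_le_gronwallBound_of_norm_deriv_right_le
    (f := fun t => (q t, p t, θ t))
    (f' := fun t => (p t, (m t)⁻¹ • (-g t (q t) - p t), -g t (θ t)))
    (δ := ‖(q₀, p₀, θ₀)‖) (K := 1 + M * (L + 1) + L) (ε := (M + 1) * G) (a := 0) (b := T)
    (((h.continuousOn_q.prodMk (h.continuousOn_p.prodMk h.continuousOn_θ))).mono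
      Set.Icc_subset_Ici_self)
    (fun x hx => (h.deriv_q x hx.1).prodMk ((h.deriv_p x hx.1).prodMk (h.deriv_θ x hx.1)))
    (by simp [h.q_zero, h.p_zero, h.θ_zero])
    (fun x hx => by
      set n := ‖(q x, p x, θ x)‖
      have hn : 0 ≤ n := norm_nonneg _
      have hq : ‖q x‖ ≤ n := norm_fst_le (q x, p x, θ x)
      have hpθ : ‖(p x, θ x)‖ ≤ n := norm_snd_le (q x, p x, θ x)
      have hp : ‖p x‖ ≤ n := (norm_fst_le (p x, θ x)).trans hpθ
      have hθ : ‖θ x‖ ≤ n := (norm_snd_le (p x, θ x)).trans hpθ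
      have hm : (m x)⁻¹ ≤ M := inv_anti₀ (hpos T hT) (hanti hx.1 hT hx.2.le)
      have hm0 : 0 ≤ (m x)⁻¹ := (inv_pos.2 (hpos x hx.1)).le
      have h1 : ‖-g x (q x) - p x‖ ≤ G + L * n + n := by
        refine (norm_sub_le _ _).trans ?_
        rw [norm_neg]
        have := hg.norm_le x (q x)
        have := mul_le_mul_of_nonneg_left hq hL
        linarith
      have h2 : ‖(m x)⁻¹ • (-g x (q x) - p x)‖ ≤ M * (G + L * n + n) := by
        rw [norm_smul, Real.norm_of_nonneg hm0]
        gcongr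
      have h3 : ‖-g x (θ x)‖ ≤ G + L * n := by
        rw [norm_neg]
        have := hg.norm_le x (θ x)
        have := mul_le_mul_of_nonneg_left hθ hL
        linarith
      have e1 : 0 ≤ M * G := by positivity
      have e2 : 0 ≤ M * (L + 1) * n := by positivity
      have e3 : 0 ≤ L * n := by positivity
      rw [Prod.norm_def, Prod.norm_def]
      refine max_le ?_ (max_le ?_ ?_) <;> simp only <;> nlinarith)
    t ht
  have key' := key.trans (gronwallBound_mono (norm_nonneg _) (by positivity) (by positivity)
    (show t - 0 ≤ T by linarith [ht.2]))
  have hpθ := (norm_snd_le (q t, p t, θ t)).trans key'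
  exact ⟨(norm_fst_le (q t, p t, θ t)).trans key', (norm_fst_le (p t, θ t)).trans hpθ,
    (norm_snd_le (p t, θ t)).trans hpθ⟩

/-- The right derivative of `m p`. -/
lemma IsCoupledPath.hasDerivWithinAt_smul (h : IsCoupledPath m g q₀ p₀ θ₀ q p θ)
    {t m' : ℝ} (ht : 0 ≤ t) (hm : 0 < m t) (hm' : HasDerivWithinAt m m' (Set.Ici t) t) :
    HasDerivWithinAt (fun s => m s • p s) (m' • p t - g t (q t) - p t) (Set.Ici t) t := by
  convert! hm'.smul (h.deriv_p t ht) using 1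
  rw [smul_inv_smul₀ hm.ne']
  abel

/-- The right derivative of `q + m p`, in which the stiff terms cancel. -/
lemma IsCoupledPath.hasDerivWithinAt_add_smul (h : IsCoupledPath m g q₀ p₀ θ₀ q p θ)
    {t m' : ℝ} (ht : 0 ≤ t) (hm : 0 < m t) (hm' : HasDerivWithinAt m m' (Set.Ici t) t) :
    HasDerivWithinAt (fun s => q s + m s • p s) (m' • p t - g t (q t)) (Set.Ici t) t := by
  convert! (h.deriv_q t ht).add (h.hasDerivWithinAt_smul ht hm hm') using 1
  abel

/-- This is the source of damping: pairing `μ • x` with `-x` produces `-μ⁻¹ ‖μ • x‖²`, whose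
coefficient is arbitrarily large for small mass. The other two terms are Cauchy–Schwarz. -/
lemma inner_smul_sub_sub_le {x : E} {μ ν B : ℝ} {v : E} (hμ : 0 < μ)
    (hν : |ν| ≤ μ) (hv : ‖v‖ ≤ B) :
    inner ℝ (μ • x) (ν • x - v - x) ≤ ‖μ • x‖ ^ 2 + ‖μ • x‖ * B - μ⁻¹ * ‖μ • x‖ ^ 2 := by
  have h1 : inner ℝ (μ • x) (ν • x) ≤ ‖μ • x‖ ^ 2 := by
    refine (real_inner_le_norm _ _).trans ?_
    rw [sq]
    gcongr ?_ * ?_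
    rw [norm_smul, norm_smul, Real.norm_of_nonneg hμ.le, Real.norm_eq_abs]
    gcongr
  have h2 : -inner ℝ (μ • x) v ≤ ‖μ • x‖ * B := by
    rw [← inner_neg_right]
    refine (real_inner_le_norm _ _).trans ?_
    rw [norm_neg]
    gcongr
  have h3 : inner ℝ (μ • x) x = μ⁻¹ * ‖μ • x‖ ^ 2 := by
    rw [norm_smul, real_inner_smul_left, real_inner_self_eq_norm_sq, mul_pow,
      Real.norm_of_nonneg hμ.le]
    field_simp
  rw [inner_sub_right, inner_sub_right]
  linarith

/-- Dissipation of `‖q + m p - θ‖²`, compared with an arbitrary reference point. -/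
lemma IsMonotoneField.inner_le (hg : IsMonotoneField κ L G g) {x y z : E} {t μ ν : ℝ}
    (hν : |ν| ≤ μ) :
    inner ℝ (x + μ • y - z) (ν • y - (g t x - g t z)) ≤
      -κ * ‖x + μ • y - z‖ ^ 2 + (L + 1) * (‖x + μ • y - z‖ * ‖μ • y‖) := by
  set u := x + μ • y
  have hμ : 0 ≤ μ := (abs_nonneg _).trans hν
  have h1 : inner ℝ (u - z) (ν • y) ≤ ‖u - z‖ * ‖μ • y‖ := by
    refine (real_inner_le_norm _ _).trans ?_
    gcongr ?_ * ?_
    rw [norm_smul, norm_smul, Real.norm_of_nonneg hμ, Real.norm_eq_abs]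
    gcongr
  have h2 := hg.monotone t u z
  have h3 : inner ℝ (u - z) (g t u - g t x) ≤ ‖u - z‖ * (L * ‖μ • y‖) := by
    refine (real_inner_le_norm _ _).trans ?_
    gcongr
    simpa [u] using hg.lipschitz t u x
  -- Monotonicity is used between `u` and `z`, not `x` and `z`; replacing `x` by `u` costs `L ‖u -
  -- x‖ = L ‖μ • y‖`.
  have h4 : ν • y - (g t x - g t z) = ν • y + (g t u - g t x) - (g t u - g t z) := by abel
  rw [h4, inner_sub_right, inner_add_right]
  linarith

/-- Young's inequality, weighted so that the two cross terms of the energy estimate, each doubled,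
use up `κ` of the available `2κ`. -/
lemma mul_mul_le_sq_add_sq {a b c κ : ℝ} (hκ : 0 < κ) :
    c * (a * b) ≤ κ / 4 * a ^ 2 + c ^ 2 / κ * b ^ 2 := by
  have h : κ / 4 * a ^ 2 + c ^ 2 / κ * b ^ 2 - c * (a * b) = (κ * a / 2 - c * b) ^ 2 / κ := by
    field_simp; ring
  have : 0 ≤ (κ * a / 2 - c * b) ^ 2 / κ := by positivity
  linarith

/-- The energy `‖q + m p‖² + ‖m p‖²` is dissipated up to a constant while the mass is small. -/
lemma IsMonotoneField.energy_deriv_le (hg : IsMonotoneField κ L G g) (hκ : 0 < κ) (hL : 0 ≤ L)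
    {x y : E} {t μ ν : ℝ} (hμ : 0 < μ) (hν : |ν| ≤ μ)
    (hc : 2 * (κ + (2 * L + 1) ^ 2 / κ + 2 + L) ≤ μ⁻¹) :
    2 * inner ℝ (x + μ • y) (ν • y - g t x) + 2 * inner ℝ (μ • y) (ν • y - g t x - y) ≤
      -κ * (‖x + μ • y‖ ^ 2 + ‖μ • y‖ ^ 2) + 2 * (G ^ 2 / κ + G ^ 2) := by
  have h1 := hg.inner_le (x := x) (y := y) (z := 0) (t := t) hν
  rw [sub_zero] at h1
  have h1' : inner ℝ (x + μ • y) (ν • y - g t x) ≤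
      inner ℝ (x + μ • y) (ν • y - (g t x - g t 0)) + ‖x + μ • y‖ * G := by
    have e : ν • y - g t x = ν • y - (g t x - g t 0) + -g t 0 := by abel
    rw [e, inner_add_right]
    gcongr
    refine (real_inner_le_norm _ _).trans ?_
    rw [norm_neg]
    gcongr
    exact hg.norm_zero_le t
  have hgq : ‖g t x‖ ≤ G + L * (‖x + μ • y‖ + ‖μ • y‖) := by
    refine (hg.norm_le t x).trans ?_
    gcongr
    simpa using norm_sub_le (x + μ • y) (μ • y)
  have h2 := inner_smul_sub_sub_le (x := y) hμ hν hgq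
  set a := ‖x + μ • y‖
  set b := ‖μ • y‖
  have h3 := mul_le_mul_of_nonneg_right hc (sq_nonneg b)
  have h4 := mul_mul_le_sq_add_sq (a := a) (b := b) (c := 2 * L + 1) hκ
  have h5 := mul_mul_le_sq_add_sq (a := a) (b := 1) (c := G) hκ
  have h6 : b * G ≤ b ^ 2 + G ^ 2 := by nlinarith [sq_nonneg (b - G)]
  have h7 : 0 ≤ (2 * L + 1) ^ 2 / κ * b ^ 2 := by positivity
  have h8 : 0 ≤ L * b ^ 2 := by positivity
  have h9 : 0 ≤ κ * b ^ 2 := by positivity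
  have h10 : 0 ≤ b ^ 2 := by positivity
  linarith

/-- The distance `‖q + m p - θ‖² + ‖m p‖²` is dissipated up to an error proportional to the mass. -/
lemma IsMonotoneField.distance_deriv_le (hg : IsMonotoneField κ L G g) (hκ : 0 < κ) (hL : 0 ≤ L)
    {x y z : E} {t μ ν B : ℝ} (hμ : 0 < μ) (hν : |ν| ≤ μ)
    (hc : 2 * (κ + (2 * L + 1) ^ 2 / κ + 2 + L) ≤ μ⁻¹) (hB : ‖g t x‖ ≤ B) :
    2 * inner ℝ (x + μ • y - z) (ν • y - g t x - -g t z)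
        + 2 * inner ℝ (μ • y) (ν • y - g t x - y) ≤
      -κ * (‖x + μ • y - z‖ ^ 2 + ‖μ • y‖ ^ 2) + B ^ 2 * μ := by
  have h1 := hg.inner_le (x := x) (y := y) (z := z) (t := t) hν
  have h1' : ν • y - g t x - -g t z = ν • y - (g t x - g t z) := by abel
  have h2 := inner_smul_sub_sub_le (x := y) hμ hν hB
  rw [h1']
  set w := ‖x + μ • y - z‖
  set b := ‖μ • y‖
  have h3 := mul_le_mul_of_nonneg_right hc (sq_nonneg b)
  have h4 := mul_mul_le_sq_add_sq (a := w) (b := b) (c := L + 1) hκ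
  -- The weight `μ` spends half of the friction and leaves an error of order `μ` that vanishes with
  -- the mass. The factor `2` in `hc` lets the remaining half dominate the other terms.
  have h6 : b * B ≤ μ⁻¹ * b ^ 2 / 2 + B ^ 2 * μ / 2 := by
    have e : μ⁻¹ * b ^ 2 / 2 + B ^ 2 * μ / 2 - b * B = (b - μ * B) ^ 2 / (2 * μ) := by
      field_simp; ring
    have : 0 ≤ (b - μ * B) ^ 2 / (2 * μ) := by positivity
    linarith
  have h7 : (L + 1) ^ 2 / κ * b ^ 2 ≤ (2 * L + 1) ^ 2 / κ * b ^ 2 := by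
    gcongr
    linarith
  have h8 : 0 ≤ L * b ^ 2 := by positivity
  have h9 : 0 ≤ κ * b ^ 2 := by positivity
  have h10 : 0 ≤ κ * w ^ 2 := by positivity
  have h11 : 0 ≤ b ^ 2 := by positivity
  linarith

/-- Uniform boundedness and pathwise convergence of the difference of the two solutions, in one
statement so that the time from which on the mass is small is shared. As the mass tends to zero, no
smallness of its initial value is needed, and the estimates hold along every single path. -/
lemma exists_bound_and_tendsto (hκ : 0 < κ) (hL : 0 ≤ L) (hG : 0 ≤ G)
    (hpos : ∀ t, 0 ≤ t → 0 < m t) (hanti : AntitoneOn m (Set.Ici 0))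
    (hdiff : DifferentiableOn ℝ m (Set.Ici 0)) (hlim : Tendsto m atTop (𝓝 0))
    (hderiv : ∀ t, 0 < t → |deriv m t| ≤ m t) (q₀ p₀ θ₀ : E) :
    ∃ R, ∀ (g : ℝ → E → E) (q p θ : ℝ → E), IsMonotoneField κ L G g →
      IsCoupledPath m g q₀ p₀ θ₀ q p θ →
      (∀ t, 0 ≤ t → ‖q t - θ t‖ ≤ R) ∧ Tendsto (fun t => ‖q t - θ t‖) atTop (𝓝 0) := by
  set c : ℝ := 2 * (κ + (2 * L + 1) ^ 2 / κ + 2 + L) with hc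
  have hcpos : 0 < c := by positivity
  -- The requirement `1 ≤ T` keeps all later times in the open half-line, where `m` has a two-sided
  -- derivative and `|m'| ≤ m` holds.
  obtain ⟨T, hT, hmT⟩ : ∃ T, 1 ≤ T ∧ ∀ t, T ≤ t → m t ≤ c⁻¹ := by
    have := (hlim.eventually_le_const (show 0 < c⁻¹ by positivity)).and (eventually_ge_atTop 1)
    obtain ⟨T, hT⟩ := this.exists_forall_of_atTop
    exact ⟨T, (hT T le_rfl).2, fun t ht => (hT t ht).1⟩
  have hT0 : 0 ≤ T := by linarith
  obtain ⟨R₀, hR₀⟩ := exists_norm_le_of_isCoupledPath (κ := κ) hL hG hpos hanti q₀ p₀ θ₀ T hT0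
  have hmd : ∀ t, T ≤ t → HasDerivWithinAt m (deriv m t) (Set.Ici t) t := fun t ht =>
    ((hdiff.differentiableAt (Ici_mem_nhds (by linarith))).hasDerivAt).hasDerivWithinAt
  have hmi : ∀ t, T ≤ t → c ≤ (m t)⁻¹ := fun t ht => by
    have := inv_anti₀ (hpos t (by linarith)) (hmT t ht)
    rwa [inv_inv] at this
  set E₀ := (R₀ + m T * R₀) ^ 2 + (m T * R₀) ^ 2 with hE₀
  set ε₀ := 2 * (G ^ 2 / κ + G ^ 2) with hε₀
  have hε₀' : 0 ≤ ε₀ := by positivity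
  -- `R₁` bounds both `‖q + m p‖` and `‖m p‖`, hence `‖q‖ ≤ 2 R₁`, and `B` then bounds the field
  -- along `q`.
  set R₁ := √(E₀ + ε₀ / κ) with hR₁
  set B := G + L * (R₁ + R₁) with hB
  set F₀ := (R₀ + m T * R₀ + R₀) ^ 2 + (m T * R₀) ^ 2 with hF₀
  have hF₀' : 0 ≤ F₀ := by positivity
  set R₂ := F₀ + B ^ 2 * m T / κ with hR₂
  refine ⟨max (R₀ + R₀) (√R₂ + √R₂), fun g q p θ hg h => ?_⟩
  have hmc : ContinuousOn m (Set.Ici T) := (hdiff.continuousOn).mono (Set.Ici_subset_Ici.2 hT0)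
  have hqc := h.continuousOn_q.mono (Set.Ici_subset_Ici.2 hT0)
  have hpc := h.continuousOn_p.mono (Set.Ici_subset_Ici.2 hT0)
  have hθc := h.continuousOn_θ.mono (Set.Ici_subset_Ici.2 hT0)
  set r : ℝ → E := fun t => m t • p t with hr
  have hmTp := hpos T hT0
  obtain ⟨hqT, hpT, hθT⟩ := hR₀ g q p θ hg h T ⟨hT0, le_rfl⟩
  have hR₀' : 0 ≤ R₀ := (norm_nonneg _).trans hqT
  have hrT : ‖r T‖ ≤ m T * R₀ := by
    rw [hr, norm_smul, Real.norm_of_nonneg hmTp.le]; gcongr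
  have huT : ‖q T + r T‖ ≤ R₀ + m T * R₀ := (norm_add_le _ _).trans (add_le_add hqT hrT)
  have hwT : ‖q T + r T - θ T‖ ≤ R₀ + m T * R₀ + R₀ :=
    (norm_sub_le _ _).trans (add_le_add huT hθT)
  -- the energy of the momentum system stays bounded
  have hE : ∀ t, T ≤ t → ‖q t + r t‖ ^ 2 + ‖r t‖ ^ 2 ≤ E₀ + ε₀ / κ := by
    intro t ht
    have := le_of_deriv_right_le_neg_mul_add (f := fun t => ‖q t + r t‖ ^ 2 + ‖r t‖ ^ 2)
      (f' := fun t => 2 * inner ℝ (q t + r t) (deriv m t • p t - g t (q t))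
        + 2 * inner ℝ (r t) (deriv m t • p t - g t (q t) - p t)) (a := T) hκ hε₀'
      (((hqc.add (hmc.smul hpc)).norm.pow 2).add ((hmc.smul hpc).norm.pow 2))
      (fun s hs => by
        have hs0 : 0 ≤ s := hT0.trans hs
        exact ((h.hasDerivWithinAt_add_smul hs0 (hpos s hs0) (hmd s hs)).norm_sq).add
          ((h.hasDerivWithinAt_smul hs0 (hpos s hs0) (hmd s hs)).norm_sq))
      (fun s hs => by
        have hs0 : 0 ≤ s := hT0.trans hs
        exact hg.energy_deriv_le hκ hL (hpos s hs0) (hderiv s (by linarith)) (hmi s hs)) t ht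
    refine this.trans ?_
    gcongr
    have e1 : Real.exp (-κ * (t - T)) ≤ 1 := by
      apply Real.exp_le_one_iff.2
      exact mul_nonpos_of_nonpos_of_nonneg (neg_nonpos.2 hκ.le) (sub_nonneg.2 ht)
    have e2 : ‖q T + r T‖ ^ 2 + ‖r T‖ ^ 2 ≤ E₀ := by rw [hE₀]; gcongr
    refine (mul_le_of_le_one_right (by positivity) e1).trans e2
  have hgB : ∀ t, T ≤ t → ‖g t (q t)‖ ≤ B := by
    intro t ht
    have h1 : ‖q t + r t‖ ≤ R₁ := Real.le_sqrt_of_sq_le (by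
      have := hE t ht; linarith [sq_nonneg ‖r t‖])
    have h2 : ‖r t‖ ≤ R₁ := Real.le_sqrt_of_sq_le (by
      have := hE t ht; linarith [sq_nonneg ‖q t + r t‖])
    refine (hg.norm_le t (q t)).trans ?_
    rw [hB]
    gcongr
    calc ‖q t‖ = ‖(q t + r t) - r t‖ := by simp
      _ ≤ _ := (norm_sub_le _ _).trans (add_le_add h1 h2)
  -- decay of the distance to the gradient flow
  have hF : ∀ a, T ≤ a → ∀ t, a ≤ t → ‖q t + r t - θ t‖ ^ 2 + ‖r t‖ ^ 2 ≤
      (‖q a + r a - θ a‖ ^ 2 + ‖r a‖ ^ 2) * Real.exp (-κ * (t - a)) + B ^ 2 * m a / κ := by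
    intro a ha
    have hsub := Set.Ici_subset_Ici.2 ha
    refine le_of_deriv_right_le_neg_mul_add (f := fun t => ‖q t + r t - θ t‖ ^ 2 + ‖r t‖ ^ 2)
      (f' := fun t => 2 * inner ℝ (q t + r t - θ t) (deriv m t • p t - g t (q t) - -g t (θ t))
        + 2 * inner ℝ (r t) (deriv m t • p t - g t (q t) - p t)) (a := a) hκ
      (by have := hpos a (hT0.trans ha); positivity)
      (((((hqc.add (hmc.smul hpc)).sub hθc).norm.pow 2).add ((hmc.smul hpc).norm.pow 2)).mono hsub)
      (fun s hs => ?_) (fun s hs => ?_)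
    · have hs' : T ≤ s := ha.trans hs
      have hs0 : 0 ≤ s := hT0.trans hs'
      exact (((h.hasDerivWithinAt_add_smul hs0 (hpos s hs0) (hmd s hs')).sub
        (h.deriv_θ s hs0)).norm_sq).add
          ((h.hasDerivWithinAt_smul hs0 (hpos s hs0) (hmd s hs')).norm_sq)
    · have hs' : T ≤ s := ha.trans hs
      have hs0 : 0 ≤ s := hT0.trans hs'
      refine (hg.distance_deriv_le hκ hL (hpos s hs0) (hderiv s (by linarith)) (hmi s hs')
        (hgB s hs')).trans ?_
      gcongr
      exact hanti (hT0.trans ha) hs0 hs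
  have hdist : ∀ t, ∀ S, ‖q t + r t - θ t‖ ^ 2 + ‖r t‖ ^ 2 ≤ S → ‖q t - θ t‖ ≤ √S + √S := by
    intro t S hS
    have h1 : ‖q t + r t - θ t‖ ≤ √S := Real.le_sqrt_of_sq_le (by linarith [sq_nonneg ‖r t‖])
    have h2 : ‖r t‖ ≤ √S := Real.le_sqrt_of_sq_le (by linarith [sq_nonneg ‖q t + r t - θ t‖])
    calc ‖q t - θ t‖ = ‖(q t + r t - θ t) - r t‖ := by congr 1; abel
      _ ≤ _ := (norm_sub_le _ _).trans (add_le_add h1 h2)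
  have hFbd : ∀ t, T ≤ t → ‖q t + r t - θ t‖ ^ 2 + ‖r t‖ ^ 2 ≤ R₂ := by
    intro t ht
    refine (hF T le_rfl t ht).trans ?_
    rw [hR₂]
    gcongr
    have e1 : Real.exp (-κ * (t - T)) ≤ 1 := by
      apply Real.exp_le_one_iff.2
      exact mul_nonpos_of_nonpos_of_nonneg (neg_nonpos.2 hκ.le) (sub_nonneg.2 ht)
    have e2 : ‖q T + r T - θ T‖ ^ 2 + ‖r T‖ ^ 2 ≤ F₀ := by rw [hF₀]; gcongr
    exact (mul_le_of_le_one_right (by positivity) e1).trans e2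
  refine ⟨fun t ht => ?_, ?_⟩
  · rcases le_total t T with htT | htT
    · obtain ⟨h1, -, h3⟩ := hR₀ g q p θ hg h t ⟨ht, htT⟩
      exact ((norm_sub_le _ _).trans (add_le_add h1 h3)).trans (le_max_left _ _)
    · exact (hdist t _ (hFbd t htT)).trans (le_max_right _ _)
  · have hFlim : Tendsto (fun t => ‖q t + r t - θ t‖ ^ 2 + ‖r t‖ ^ 2) atTop (𝓝 0) := by
      -- Restarting the estimate at time `t / 2` makes both terms vanish: the initial value is at
      -- most `R₂` and decays over a time `t / 2`, while the forcing is controlled by `m (t / 2)`.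
      have hhalf : Tendsto (fun t : ℝ => t / 2) atTop atTop :=
        tendsto_id.atTop_div_const (by norm_num)
      have hb : Tendsto (fun t : ℝ => R₂ * Real.exp (-κ * (t - t / 2)) + B ^ 2 * m (t / 2) / κ)
          atTop (𝓝 0) := by
        have h1 : Tendsto (fun t : ℝ => Real.exp (-κ * (t - t / 2))) atTop (𝓝 0) := by
          refine Real.tendsto_exp_atBot.comp ?_
          have : (fun t : ℝ => -κ * (t - t / 2)) = fun t => -κ * (t / 2) := by
            funext t; ring
          rw [this]
          exact hhalf.const_mul_atTop_of_neg (by linarith)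
        have h2 := hlim.comp hhalf
        simpa using (h1.const_mul R₂).add ((h2.const_mul (B ^ 2)).div_const κ)
      refine tendsto_of_tendsto_of_tendsto_of_le_of_le' tendsto_const_nhds hb
        (Eventually.of_forall fun t => by positivity) ?_
      filter_upwards [eventually_ge_atTop (2 * T)] with t ht
      refine (hF (t / 2) (by linarith) t (by linarith)).trans ?_
      gcongr
      exact hFbd (t / 2) (by linarith)
    have hs : Tendsto (fun t => √(‖q t + r t - θ t‖ ^ 2 + ‖r t‖ ^ 2) +
        √(‖q t + r t - θ t‖ ^ 2 + ‖r t‖ ^ 2)) atTop (𝓝 0) := by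
      have := (Real.continuous_sqrt.tendsto 0).comp hFlim
      rw [Real.sqrt_zero] at this
      simpa using this.add this
    exact squeeze_zero (fun t => norm_nonneg _) (fun t => hdist t _ le_rfl) hs

end Deterministic


/-! ### Jump times of càdlàg paths in a discrete space -/

section Paths

variable {ι : Type*} [TopologicalSpace ι] [DiscreteTopology ι] {x : ℝ → ι}

/-- On an open set, constancy near `t` is constancy around each nearby point. Applied to the two
open sides of `t`, it shows that discontinuities cannot accumulate. -/
lemma eventually_continuousAt_of_eventually_eq {ι : Type*} [TopologicalSpace ι] {x : ℝ → ι} {l : ι} {s : Set ℝ} (hs : IsOpen s) {t : ℝ}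
    (h : ∀ᶠ r in 𝓝[s] t, x r = l) : ∀ᶠ r in 𝓝[s] t, ContinuousAt x r := by
  filter_upwards [eventually_eventually_nhdsWithin.2 h, self_mem_nhdsWithin] with r hr hrs
  rw [hs.nhdsWithin_eq hrs] at hr
  exact (continuousAt_const (y := l)).congr (hr.mono fun _ h => h.symm)

lemma IsCadlag.eventually_eq_right (hx : IsCadlag x) {t : ℝ} (ht : 0 ≤ t) :
    ∀ᶠ r in 𝓝[≥] t, x r = x t := by
  have := hx.1 t ht
  rwa [ContinuousWithinAt, nhds_discrete, tendsto_pure] at this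

lemma IsCadlag.exists_eventually_eq_left (hx : IsCadlag x) {t : ℝ} (ht : 0 < t) :
    ∃ l, ∀ᶠ r in 𝓝[<] t, x r = l := by
  obtain ⟨l, hl⟩ := hx.2 t ht
  rw [nhds_discrete, tendsto_pure] at hl
  exact ⟨l, hl⟩

lemma IsCadlag.eventually_continuousAt_right (hx : IsCadlag x) {t : ℝ} (ht : 0 ≤ t) :
    ∀ᶠ r in 𝓝[>] t, ContinuousAt x r :=
  eventually_continuousAt_of_eventually_eq isOpen_Ioi
    ((hx.eventually_eq_right ht).filter_mono (nhdsWithin_mono _ Set.Ioi_subset_Ici_self))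

lemma IsCadlag.eventually_continuousAt_left (hx : IsCadlag x) {t : ℝ} (ht : 0 < t) :
    ∀ᶠ r in 𝓝[<] t, ContinuousAt x r := by
  obtain ⟨l, hl⟩ := hx.exists_eventually_eq_left ht
  exact eventually_continuousAt_of_eventually_eq isOpen_Iio hl

/-- If a càdlàg path has a discontinuity after time `t`, then it has a first one. -/
lemma IsCadlag.isLeast_sInf (hx : IsCadlag x) {t : ℝ} (ht : 0 ≤ t)
    (hne : {s | t < s ∧ ¬ ContinuousAt x s}.Nonempty) :
    IsLeast {s | t < s ∧ ¬ ContinuousAt x s} (sInf {s | t < s ∧ ¬ ContinuousAt x s}) := by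
  set D := {s | t < s ∧ ¬ ContinuousAt x s}
  have hbdd : BddBelow D := ⟨t, fun s hs => hs.1.le⟩
  have hglb : IsGLB D (sInf D) := isGLB_csInf hne hbdd
  have ha : t ≤ sInf D := hglb.2 fun s hs => hs.1.le
  refine ⟨?_, hglb.1⟩
  -- An infimum that is not attained would be a limit of discontinuities from the right.
  by_contra hmem
  obtain ⟨u, hu, hcont⟩ := mem_nhdsGT_iff_exists_Ioo_subset.1
    (hx.eventually_continuousAt_right (ht.trans ha))
  obtain ⟨d, hd, had, hdu⟩ := hglb.exists_between hu
  have hne' : sInf D ≠ d := fun h => hmem (h ▸ hd)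
  exact hd.2 (hcont ⟨lt_of_le_of_ne had hne', hdu⟩)

/-- A continuous path on an interval is constant by connectedness. Right-continuity takes care of
the left endpoint, so the discontinuity lies strictly after `a`. -/
lemma IsCadlag.exists_not_continuousAt (hx : IsCadlag x) {a b : ℝ} (ha : 0 ≤ a) (hab : a ≤ b)
    (hne : x a ≠ x b) : ∃ s, a < s ∧ s ≤ b ∧ ¬ ContinuousAt x s := by
  by_contra! h
  have hc : ContinuousOn x (Set.Icc a b) := by
    intro s hs
    rcases hs.1.eq_or_lt with rfl | has
    · exact (hx.1 _ ha).mono Set.Icc_subset_Ici_self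
    · exact (h s has hs.2).continuousWithinAt
  exact hne (isPreconnected_Icc.constant hc (Set.left_mem_Icc.2 hab) (Set.right_mem_Icc.2 hab))

/-- A discontinuity of a càdlàg path is seen at rational times arbitrarily close to it. -/
lemma IsCadlag.exists_nnrat_ne (hx : IsCadlag x) {lo s hi : ℝ} (hlo : 0 ≤ lo) (hs : lo < s)
    (hhi : s < hi) (hd : ¬ ContinuousAt x s) :
    ∃ a b : ℚ≥0, lo < ((a : ℚ) : ℝ) ∧ ((a : ℚ) : ℝ) < s ∧ s < ((b : ℚ) : ℝ) ∧
      ((b : ℚ) : ℝ) < hi ∧ x ((a : ℚ) : ℝ) ≠ x ((b : ℚ) : ℝ) := by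
  have hs0 : 0 < s := hlo.trans_lt hs
  have hr := hx.eventually_eq_right hs0.le
  obtain ⟨l, hl⟩ := hx.exists_eventually_eq_left hs0
  have hne : l ≠ x s := by
    rintro rfl
    refine hd ?_
    rw [ContinuousAt, nhds_discrete ι, tendsto_pure, ← nhdsLT_sup_nhdsGE]
    exact eventually_sup.2 ⟨hl, hr⟩
  obtain ⟨c, hc, hcs⟩ := mem_nhdsLT_iff_exists_Ioo_subset.1 hl
  obtain ⟨d, hd, hds⟩ := mem_nhdsGE_iff_exists_Ico_subset.1 hr
  obtain ⟨a, ha, has⟩ := exists_rat_btwn (max_lt hs hc)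
  obtain ⟨b, hsb, hb⟩ := exists_rat_btwn (lt_min hhi hd)
  have ha0 : 0 ≤ a := by
    exact_mod_cast (hlo.trans (le_max_left lo c)).trans ha.le
  have hb0 : 0 ≤ b := by exact_mod_cast hs0.le.trans hsb.le
  lift a to ℚ≥0 using ha0
  lift b to ℚ≥0 using hb0
  have h1 : x ((a : ℚ) : ℝ) = l := hcs ⟨(le_max_right _ _).trans_lt ha, has⟩
  have h2 : x ((b : ℚ) : ℝ) = x s := hds ⟨hsb.le, hb.trans_le (min_le_right _ _)⟩
  exact ⟨a, b, (le_max_left _ _).trans_lt ha, has, hsb, hb.trans_le (min_le_left _ _),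
    by rwa [h1, h2]⟩

lemma jumpTime_nonneg {ι : Type*} [TopologicalSpace ι] (x : ℝ → ι) (n : ℕ) :
    0 ≤ jumpTime x n := by
  induction n with
  | zero => exact le_rfl
  | succ n ih => exact Real.sInf_nonneg fun s hs => ih.trans hs.1.le

/-- A càdlàg path that is not eventually constant along the integers jumps infinitely often. -/
lemma IsCadlag.isLeast_jumpTime (hx : IsCadlag x)
    (hnc : ∀ (M : ℕ) (j : ι), ∃ n, M ≤ n ∧ x (n : ℝ) ≠ j) (n : ℕ) :
    IsLeast {t | jumpTime x n < t ∧ ¬ ContinuousAt x t} (jumpTime x (n + 1)) := by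
  refine hx.isLeast_sInf (jumpTime_nonneg x n) ?_
  obtain ⟨k, hk, hne⟩ := hnc ⌈jumpTime x n⌉₊ (x (⌈jumpTime x n⌉₊ : ℝ))
  obtain ⟨s, hs, -, hd⟩ := hx.exists_not_continuousAt (Nat.cast_nonneg _)
    (Nat.cast_le.2 hk) hne.symm
  exact ⟨s, (Nat.le_ceil _).trans_lt hs, hd⟩

/-- Bounded jump times would increase strictly to a finite limit, and the left limit of the path
there excludes discontinuities just before it. -/
lemma IsCadlag.tendsto_jumpTime (hx : IsCadlag x)
    (h : ∀ n, IsLeast {t | jumpTime x n < t ∧ ¬ ContinuousAt x t} (jumpTime x (n + 1))) :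
    Tendsto (jumpTime x) atTop atTop := by
  have hmono : StrictMono (jumpTime x) := strictMono_nat_of_lt_succ fun n => (h n).1.1
  rcases tendsto_atTop_of_monotone hmono.monotone with hT | ⟨a, ha⟩
  · exact hT
  exfalso
  have hlt : ∀ n, jumpTime x n < a := fun n =>
    (hmono n.lt_succ_self).trans_le (hmono.monotone.ge_of_tendsto ha _)
  have ha' : Tendsto (jumpTime x) atTop (𝓝[<] a) :=
    tendsto_nhdsWithin_iff.2 ⟨ha, Eventually.of_forall hlt⟩
  have hev := ha'.eventually (hx.eventually_continuousAt_left (hlt 0))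
  obtain ⟨n, hn⟩ := ((tendsto_add_atTop_nat 1).eventually hev).exists
  exact (h n).1.2 hn

/-- The jump times as countable infima over rational times; they are `⊤` after the last jump. -/
noncomputable def rationalJumpTime {ι : Type*} (x : ℝ → ι) : ℕ → ENNReal
  | 0 => 0
  | n + 1 => ⨅ (a : ℚ≥0) (b : ℚ≥0), open scoped Classical in
      if rationalJumpTime x n < ENNReal.ofReal ((a : ℚ) : ℝ) ∧ a < b ∧
        x ((a : ℚ) : ℝ) ≠ x ((b : ℚ) : ℝ) then ENNReal.ofReal ((b : ℚ) : ℝ) else ⊤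

/-- For `≤`, rational times bracket the next jump as tightly as desired. For `≥`, different values
at `a < b` force a jump in `(a, b]`, which comes after the `n`-th one because `a` does. -/
lemma IsCadlag.rationalJumpTime_eq (hx : IsCadlag x)
    (h : ∀ n, IsLeast {t | jumpTime x n < t ∧ ¬ ContinuousAt x t} (jumpTime x (n + 1))) (n : ℕ) :
    rationalJumpTime x n = ENNReal.ofReal (jumpTime x n) := by
  induction n with
  | zero => simp [rationalJumpTime, jumpTime]
  | succ n ih =>
    have hn := jumpTime_nonneg x n
    rw [rationalJumpTime, ih]
    apply le_antisymm
    · refine ENNReal.le_of_forall_pos_le_add fun ε hε _ => ?_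
      obtain ⟨a, b, h1, h2, h3, h4, h5⟩ := hx.exists_nnrat_ne hn (h n).1.1
        (lt_add_of_pos_right (jumpTime x (n + 1)) (NNReal.coe_pos.2 hε)) (h n).1.2
      refine (iInf₂_le a b).trans ?_
      have h6 : ENNReal.ofReal (jumpTime x n) < ENNReal.ofReal ((a : ℚ) : ℝ) :=
        (ENNReal.ofReal_lt_ofReal_iff (hn.trans_lt h1)).2 h1
      have h7 : a < b := by exact_mod_cast h2.trans h3
      rw [if_pos ⟨h6, h7, h5⟩]
      exact (ENNReal.ofReal_le_ofReal h4.le).trans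
        (ENNReal.ofReal_add_le.trans_eq (by rw [ENNReal.ofReal_coe_nnreal]))
    · refine le_iInf₂ fun a b => ?_
      split_ifs with hab
      · obtain ⟨h1, h2, h3⟩ := hab
        have h1' : jumpTime x n < ((a : ℚ) : ℝ) :=
          (ENNReal.ofReal_lt_ofReal_iff_of_nonneg hn).1 h1
        obtain ⟨s, hs, hsb, hd⟩ := hx.exists_not_continuousAt (a := ((a : ℚ) : ℝ))
          (b := ((b : ℚ) : ℝ)) (by exact_mod_cast a.2) (by exact_mod_cast h2.le) h3
        exact ENNReal.ofReal_le_ofReal (((h n).2 ⟨h1'.trans hs, hd⟩).trans hsb)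
      · exact le_top

/-- Only countably many operations on the values at fixed times are involved, unlike in the infimum
over all discontinuities. -/
lemma measurable_rationalJumpTime {Ω ι : Type*} [MeasurableSpace Ω] [MeasurableSpace ι]
    [DiscreteMeasurableSpace ι] [Countable ι] {X : ℝ → Ω → ι}
    (hX : ∀ t, 0 ≤ t → Measurable (X t)) (n : ℕ) :
    Measurable fun ω => rationalJumpTime (fun t => X t ω) n := by
  induction n with
  | zero => exact measurable_const
  | succ n ih =>
    simp only [rationalJumpTime]
    refine Measurable.iInf fun a => Measurable.iInf fun b => ?_
    refine Measurable.ite ?_ measurable_const measurable_const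
    refine (measurableSet_lt ih measurable_const).inter ((MeasurableSet.const _).inter ?_)
    exact ((hX _ (by exact_mod_cast a.2)).prodMk (hX _ (by exact_mod_cast b.2)))
      (MeasurableSet.of_discrete (s := {z : ι × ι | z.1 ≠ z.2}))

end Paths

/-! ### Evaluation of a process at a random time -/

section Sampling

variable {Ω E : Type*} [MeasurableSpace Ω] [NormedAddCommGroup E] [MeasurableSpace E]
  [BorelSpace E]

/-- A process with almost surely continuous paths, evaluated at a random time, is measurable. -/
lemma aemeasurable_eval_randomTime {P : Measure Ω} {Y : ℝ → Ω → E}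
    (hY : ∀ t, 0 ≤ t → Measurable (Y t))
    (hc : ∀ᵐ ω ∂P, ContinuousOn (fun t => Y t ω) (Set.Ici 0)) {σ : Ω → ℝ} (hσ : Measurable σ)
    (hσ0 : ∀ ω, 0 ≤ σ ω) : AEMeasurable (fun ω => Y (σ ω) ω) P := by
  -- The time is rounded up to the grid of mesh `1 / (k + 1)`: countably many values make the
  -- sampled process measurable, and path continuity gives the limit.
  let d : ℕ → Ω → ℝ := fun k ω => (⌈σ ω * ((k : ℝ) + 1)⌉₊ : ℝ) / ((k : ℝ) + 1)
  have hd0 : ∀ k ω, 0 ≤ d k ω := fun k ω => by positivity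
  have hd : ∀ ω, Tendsto (fun k => d k ω) atTop (𝓝 (σ ω)) := by
    intro ω
    have h1 : Tendsto (fun k : ℕ => σ ω + 1 / ((k : ℝ) + 1)) atTop (𝓝 (σ ω)) := by
      simpa using tendsto_const_nhds.add (tendsto_one_div_add_atTop_nhds_zero_nat (𝕜 := ℝ))
    refine tendsto_of_tendsto_of_tendsto_of_le_of_le tendsto_const_nhds h1 (fun k => ?_)
      fun k => ?_
    · have hk : (0 : ℝ) < (k : ℝ) + 1 := by positivity
      exact (le_div_iff₀ hk).2 (Nat.le_ceil _)
    · have hk : (0 : ℝ) < (k : ℝ) + 1 := by positivity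
      have h2 := (Nat.ceil_lt_add_one (mul_nonneg (hσ0 ω) hk.le)).le
      refine (div_le_iff₀ hk).2 (h2.trans_eq ?_)
      field_simp
  refine aemeasurable_of_tendsto_metrizable_ae atTop (f := fun k ω => Y (d k ω) ω)
    (fun k => Measurable.aemeasurable ?_) ?_
  · have h1 : Measurable fun z : Ω × ℕ => Y ((z.2 : ℝ) / ((k : ℝ) + 1)) z.1 :=
      measurable_from_prod_countable_left fun j => hY _ (div_nonneg (Nat.cast_nonneg j) (by positivity))
    exact h1.comp (measurable_id.prodMk (Nat.measurable_ceil.comp (hσ.mul_const _)))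
  · filter_upwards [hc] with ω hω
    exact (hω (σ ω) (hσ0 ω)).tendsto.comp
      (tendsto_nhdsWithin_iff.2 ⟨hd ω, Eventually.of_forall fun k => hd0 k ω⟩)

end Sampling

/-! ### The index process almost surely keeps leaving each state -/

section MarkovChain

/-- In the exponential series every power of `e` from the first on equals `e`; the correction `1 -
e` comes from the term of order zero. -/
lemma exp_smul_of_isIdempotentElem {A : Type*} [NormedRing A] [NormedAlgebra ℝ A]
    [CompleteSpace A] {e : A} (he : IsIdempotentElem e) (c : ℝ) :
    NormedSpace.exp (c • e) = (1 - e) + Real.exp c • e := by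
  have h1 := NormedSpace.exp_series_hasSum_exp' (𝕂 := ℝ) (c • e)
  have h2 : HasSum (fun n : ℕ => (if n = 0 then 1 - e else 0) + (c ^ n / n.factorial) • e)
      ((1 - e) + Real.exp c • e) := by
    refine (hasSum_ite_eq 0 (1 - e)).add (HasSum.smul_const ?_ e)
    rw [Real.exp_eq_exp_ℝ]
    exact NormedSpace.expSeries_div_hasSum_exp c
  have h3 : (fun n : ℕ => ((n.factorial : ℝ)⁻¹) • (c • e) ^ n) =
      fun n => (if n = 0 then 1 - e else 0) + (c ^ n / n.factorial) • e := by
    funext n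
    rcases n with - | n
    · simp
    · rw [if_neg n.succ_ne_zero, zero_add, smul_pow, he.pow_succ_eq, smul_smul, div_eq_inv_mul]
  rw [h3] at h1
  exact h1.unique h2

lemma matrix_exp_smul_of_isIdempotentElem {n : Type*} [Fintype n] [DecidableEq n]
    {e : Matrix n n ℝ} (he : IsIdempotentElem e) (c : ℝ) :
    NormedSpace.exp (c • e) = (1 - e) + Real.exp c • e :=
  open scoped Matrix.Norms.Operator in exp_smul_of_isIdempotentElem he c

lemma exp_rateMatrix_apply_self {N : ℕ} (hN : 1 ≤ N) (γ : ℝ) (j : Fin N) :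
    NormedSpace.exp (rateMatrix N γ) j j =
      (N : ℝ)⁻¹ + (1 - (N : ℝ)⁻¹) * Real.exp (-(N * γ)) := by
  have hN0 : (N : ℝ) ≠ 0 := by positivity
  -- `e` is the projection onto vectors of mean zero, and the rate matrix is `-Nγ e`.
  let e : Matrix (Fin N) (Fin N) ℝ := 1 - Matrix.of fun _ _ => (N : ℝ)⁻¹
  have hi : IsIdempotentElem (Matrix.of fun _ _ : Fin N => (N : ℝ)⁻¹) := by
    ext a b
    simp [Matrix.mul_apply, hN0]
  have he : IsIdempotentElem e := hi.one_sub
  have hQ : rateMatrix N γ = (-(N * γ)) • e := by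
    ext a b
    simp only [rateMatrix, e, Matrix.sub_apply, Matrix.of_apply, Matrix.smul_apply, smul_eq_mul]
    field_simp
    ring
  rw [hQ, matrix_exp_smul_of_isIdempotentElem he]
  simp [e]
  ring

/-- Observed at integer times, the chain is found again in its current state with probability `ρ`,
and `ρ < 1` because `N ≥ 2`. Occupying `j` at `n` further successive times thus has probability at
most `ρ ^ n`, and there are only countably many pairs `(M, j)`. -/
lemma IsIndexProcess.exists_ne {Ω : Type*} [MeasurableSpace Ω] {P : Measure Ω}
    [IsProbabilityMeasure P] {N : ℕ} (hN : 2 ≤ N) {γ : ℝ} (hγ : 0 < γ) {i : ℝ → Ω → Fin N}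
    (hi : IsIndexProcess P N γ i) :
    ∀ᵐ ω ∂P, ∀ (M : ℕ) (j : Fin N), ∃ n, M ≤ n ∧ i (n : ℝ) ω ≠ j := by
  have hN1 : (1 : ℝ) < N := by exact_mod_cast hN
  have hinv : (N : ℝ)⁻¹ < 1 := inv_lt_one_of_one_lt₀ hN1
  have hinv0 : 0 < (N : ℝ)⁻¹ := by positivity
  set ρ : ℝ := (N : ℝ)⁻¹ + (1 - (N : ℝ)⁻¹) * Real.exp (-(N * γ)) with hρ
  have hexp : Real.exp (-(N * γ)) < 1 := Real.exp_lt_one_iff.2 (neg_neg_of_pos (by positivity))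
  have hexp0 := Real.exp_pos (-(N * γ))
  have hρ0 : 0 ≤ ρ := by nlinarith
  have hρ1 : ρ < 1 := by nlinarith
  rw [ae_all_iff]
  intro M
  rw [ae_all_iff]
  intro j
  -- `A n` is the event of being in `j` at the times `M, …, M + n`. It belongs to the past of `M +
  -- n` and already contains the condition on the present state, so the Markov property gives an
  -- exact recursion.
  let A : ℕ → Set Ω := fun n => ⋂ k ∈ Set.Iic n, {ω | i ((M + k : ℕ) : ℝ) ω = j}
  have hstep : ∀ n, P.real (A (n + 1)) = P.real (A n) * ρ := by
    intro n
    have hA : MeasurableSet[⨆ r ∈ Set.Icc (0 : ℝ) ((M + n : ℕ) : ℝ),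
        MeasurableSpace.comap (i r) inferInstance] (A n) := by
      refine MeasurableSet.biInter (Set.to_countable _) fun k hk => ?_
      have hle : MeasurableSpace.comap (i ((M + k : ℕ) : ℝ)) inferInstance ≤
          ⨆ r ∈ Set.Icc (0 : ℝ) ((M + n : ℕ) : ℝ), MeasurableSpace.comap (i r) inferInstance :=
        le_iSup₂_of_le (f := fun (r : ℝ) (_ : r ∈ Set.Icc (0 : ℝ) ((M + n : ℕ) : ℝ)) =>
          MeasurableSpace.comap (i r) inferInstance) ((M + k : ℕ) : ℝ)
          ⟨Nat.cast_nonneg _, Nat.cast_le.2 (Nat.add_le_add_left hk M)⟩ le_rfl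
      exact hle _ ⟨{j}, MeasurableSet.singleton j, rfl⟩
    have h := hi.isMarkov.markov ((M + n : ℕ) : ℝ) ((M + (n + 1) : ℕ) : ℝ) (Nat.cast_nonneg _)
      (Nat.cast_le.2 (by omega)) (A n) hA j j
    have e1 : A n ∩ {ω | i ((M + n : ℕ) : ℝ) ω = j} = A n :=
      Set.inter_eq_left.2 (Set.biInter_subset_of_mem (Set.mem_Iic.2 le_rfl))
    have e2 : A n ∩ {ω | i ((M + (n + 1) : ℕ) : ℝ) ω = j} = A (n + 1) := by
      ext ω
      simp only [A, Set.mem_inter_iff, Set.mem_iInter, Set.mem_Iic, Set.mem_ofPred_eq]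
      constructor
      · rintro ⟨h1, h2⟩ k hk
        rcases Nat.le_succ_iff.1 hk with hk | rfl
        · exact h1 k hk
        · exact h2
      · exact fun h => ⟨fun k hk => h k (hk.trans n.le_succ), h _ le_rfl⟩
    have e3 : ((M + (n + 1) : ℕ) : ℝ) - ((M + n : ℕ) : ℝ) = 1 := by push_cast; ring
    rwa [e1, e2, e3, one_smul, exp_rateMatrix_apply_self (by omega)] at h
  have hpow : ∀ n, P.real (A n) ≤ ρ ^ n := by
    intro n
    induction n with
    | zero => simp
    | succ n ih => rw [hstep, pow_succ]; gcongr
  have hle : ∀ n, P.real {ω | ¬ ∃ n, M ≤ n ∧ i (n : ℝ) ω ≠ j} ≤ ρ ^ n := fun n => by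
    refine (measureReal_mono ?_).trans (hpow n)
    intro ω hω
    simp only [ne_eq, Set.mem_ofPred_eq, not_exists, not_and, not_not] at hω
    exact Set.mem_biInter fun k _ => hω _ (Nat.le_add_right M k)
  have h0 : P.real {ω | ¬ ∃ n, M ≤ n ∧ i (n : ℝ) ω ≠ j} ≤ 0 :=
    ge_of_tendsto' (tendsto_pow_atTop_nhds_zero_of_lt_one hρ0 hρ1) hle
  exact (measureReal_eq_zero_iff).1 (le_antisymm h0 measureReal_nonneg)

end MarkovChain

end SGMP

/-! ### From pathwise estimates to expectations -/

theorem mainTheorem3 {Ω : Type*} [MeasurableSpace Ω] (P : Measure Ω) [IsProbabilityMeasure P]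
    {K N : ℕ} (hN : 1 ≤ N) (γ κ : ℝ) (L : ℝ≥0) (hγ : 0 < γ) (hκ : 0 < κ)
    (Φ : Fin N → EuclideanSpace ℝ (Fin K) → ℝ)
    (hΦ : ∀ j, ContDiff ℝ 1 (Φ j)) (hL : ∀ j, LipschitzWith L (∇ (Φ j)))
    (hconv : ∀ j, SGMP.StronglyConvex κ (Φ j))
    (m : ℝ → ℝ) (hm : SGMP.IsMass (min (κ / 4) (1 / 4)) m)
    (hm₀ : m 0 ≤ (SGMP.C2Lκ L κ ^ 2)⁻¹ * κ ^ 2 / (4 * (2 * γ * N + κ) ^ 2))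
    (i : ℝ → Ω → Fin N) (hi : SGMP.IsIndexProcess P N γ i)
    (q₀ p₀ θ₀ : EuclideanSpace ℝ (Fin K))
    (q p θ : ℝ → Ω → EuclideanSpace ℝ (Fin K))
    (hqp : SGMP.IsSGMP P Φ m i q₀ p₀ q p) (hθ : SGMP.IsSGP P Φ i θ₀ θ)
    (τ : ℕ → Ω → ℝ) (hτ : ∀ n ω, τ n ω = SGMP.jumpTime (fun t => i t ω) n) :
    -- for `N = 1` the index process is constant and has no jump times
    (2 ≤ N →
      (∀ᵐ ω ∂P, ∀ n, IsLeast {t | τ n ω < t ∧ ¬ ContinuousAt (fun s => i s ω) t} (τ (n + 1) ω)) ∧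
      (∀ n, Integrable (fun ω => q (τ n ω) ω - θ (τ n ω) ω) P) ∧
      Tendsto (fun n => ∫ ω, ‖q (τ n ω) ω - θ (τ n ω) ω‖ ∂P) atTop (𝓝 0)) ∧
    ((∃ C c : ℝ, 0 < C ∧ 0 < c ∧ ∀ t, 0 ≤ t → m t ≤ C * Real.exp (-c * t)) →
      (∀ᵐ ω ∂P, Tendsto (fun t => ‖q t ω - θ t ω‖) atTop (𝓝 0)) ∧
      (∀ t, 0 ≤ t → Integrable (fun ω => q t ω - θ t ω) P) ∧
      Tendsto (fun t => ∫ ω, ‖q t ω - θ t ω‖ ∂P) atTop (𝓝 0)) := by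
  -- The sum over the finitely many potentials bounds the gradient at the origin whichever index is
  -- active, so `R` is deterministic. The bound `|m'| ≤ m` follows from `min (κ / 4) (1 / 4) ≤ 1`.
  obtain ⟨R, hR⟩ := SGMP.exists_bound_and_tendsto (m := m) (L := L)
    (G := ∑ j, ‖∇ (Φ j) 0‖) hκ L.2 (Finset.sum_nonneg fun _ _ => norm_nonneg _) hm.pos
    hm.strictAntiOn.antitoneOn hm.differentiableOn hm.tendsto
    (fun t ht => (hm.abs_deriv_le t ht).trans (mul_le_of_le_one_left (hm.pos t ht.le).le
      ((min_le_right _ _).trans (by norm_num)))) q₀ p₀ θ₀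
  have hpath : ∀ᵐ ω ∂P, (∀ t, 0 ≤ t → ‖q t ω - θ t ω‖ ≤ R) ∧
      Tendsto (fun t => ‖q t ω - θ t ω‖) atTop (𝓝 0) := by
    filter_upwards [hqp.initial, hqp.continuousOn_q, hqp.continuousOn_p, hqp.deriv_q, hqp.deriv_p,
      hθ.initial, hθ.continuousOn, hθ.deriv] with ω h1 h2 h3 h4 h5 h6 h7 h8
    refine hR (fun t => ∇ (Φ (i t ω))) _ _ _ ⟨fun t => ?_, fun t x y => ?_, fun t => hconv _⟩
      ⟨h1.1, h1.2, h6, h2, h3, h7, h4, h5, h8⟩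
    · exact Finset.single_le_sum (f := fun j => ‖∇ (Φ j) 0‖) (fun _ _ => norm_nonneg _)
        (Finset.mem_univ (i t ω))
    · exact (hL _).norm_sub_le x y
  refine ⟨fun hN2 => ?_, fun _ => ⟨hpath.mono fun ω h => h.2, fun t ht => ?_, ?_⟩⟩
  · have hleast : ∀ᵐ ω ∂P, ∀ n,
        IsLeast {t | τ n ω < t ∧ ¬ ContinuousAt (fun s => i s ω) t} (τ (n + 1) ω) := by
      filter_upwards [hi.isMarkov.cadlag, hi.exists_ne hN2 hγ] with ω h1 h2 n
      rw [hτ, hτ]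
      exact h1.isLeast_jumpTime h2 n
    have hτ0 : ∀ n ω, 0 ≤ τ n ω := fun n ω => by
      rw [hτ]
      exact SGMP.jumpTime_nonneg _ n
    have htend : ∀ᵐ ω ∂P, Tendsto (fun n => τ n ω) atTop atTop := by
      filter_upwards [hi.isMarkov.cadlag, hleast] with ω h1 h2
      simp only [hτ] at h2 ⊢
      exact h1.tendsto_jumpTime h2
    have hmeas : ∀ n, AEStronglyMeasurable (fun ω => q (τ n ω) ω - θ (τ n ω) ω) P := by
      intro n
      -- The rational jump time is measurable everywhere and agrees with `τ n` almost surely, which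
      -- suffices for almost everywhere measurability of the sampled difference.
      have hσ := (SGMP.measurable_rationalJumpTime hi.isMarkov.measurable n).ennreal_toReal
      have h1 := (SGMP.aemeasurable_eval_randomTime hqp.measurable_q hqp.continuousOn_q hσ
        fun _ => ENNReal.toReal_nonneg).sub (SGMP.aemeasurable_eval_randomTime hθ.measurable
        hθ.continuousOn hσ fun _ => ENNReal.toReal_nonneg)
      refine (h1.congr ?_).aestronglyMeasurable
      filter_upwards [hi.isMarkov.cadlag, hleast] with ω h2 h3
      have h4 : (SGMP.rationalJumpTime (fun t => i t ω) n).toReal = τ n ω := by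
        simp only [hτ] at h3
        rw [h2.rationalJumpTime_eq h3, hτ, ENNReal.toReal_ofReal (SGMP.jumpTime_nonneg _ n)]
      simp only [Pi.sub_apply, h4]
    refine ⟨hleast, fun n => ?_, ?_⟩
    · exact Integrable.of_bound (hmeas n) R (hpath.mono fun ω h => h.1 _ (hτ0 n ω))
    -- Pathwise convergence composed with `τ n → ∞` gives the almost sure limit, and the constant
    -- `R` dominates.
    · have := tendsto_integral_of_dominated_convergence (μ := P) (f := fun _ => (0 : ℝ))
        (F := fun n ω => ‖q (τ n ω) ω - θ (τ n ω) ω‖) (fun _ => R) (fun n => (hmeas n).norm)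
        (integrable_const R)
        (fun n => hpath.mono fun ω h => by simpa using h.1 _ (hτ0 n ω))
        (by filter_upwards [hpath, htend] with ω h1 h2 using h1.2.comp h2)
      simpa using this
  · exact Integrable.of_bound ((hqp.measurable_q t ht).sub (hθ.measurable t ht)).aestronglyMeasurable
      R (hpath.mono fun ω h => h.1 t ht)
  · have := tendsto_integral_filter_of_dominated_convergence (μ := P) (l := atTop)
      (f := fun _ => (0 : ℝ)) (F := fun t ω => ‖q t ω - θ t ω‖) (fun _ => R)
      ((eventually_ge_atTop 0).mono fun t ht =>
        ((hqp.measurable_q t ht).sub (hθ.measurable t ht)).norm.aestronglyMeasurable)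
      ((eventually_ge_atTop 0).mono fun t ht => hpath.mono fun ω h => by simpa using h.1 t ht)
      (integrable_const R) (hpath.mono fun ω h => h.2)
    simpa using this
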